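/- Let $X$ be an infinite set, and let $X'=\{x':x\in X\}$ be a disjoint copy of $X$. Let $\mathcal{PB}_X$ be the partial Brauer monoid: its elements are the graphs on the vertex set $X\cup X'$ in which every vertex has degree at most $1$. The product $\alpha\beta$ of $\alpha,\beta\in\mathcal{PB}_X$ is defined as follows. Let $X''=\{x'':x\in X\}$ be a further disjoint copy of $X$, and let $\Pi(\alpha,\beta)$ be the graph on $X\cup X''\cup X'$ whose edges are those of $\alpha$ with each vertex $x'$ replaced by $x''$, together with those of $\beta$ with each vertex $x$ replaced by $x''$. Then $\alpha\beta$ has an edge $\{u,v\}$ whenever $u,v\in X\cup X'$ are distinct and lie in the same connected component of $\Pi(\alpha,\beta)$. Then: (a) $\mathcal{PB}_X$ has the semigroup Bergman property: for every subset $U$ that generates $\mathcal{PB}_X$ as a semigroup there is a natural number $N$ such that every element of $\mathcal{PB}_X$ is a product of at most $N$ (and at least one) elements of $U$. (b) $\mathcal{PB}_X$ has Sierpiński rank $2$: the least $n$ such that every countable subset of $\mathcal{PB}_X$ is contained in a subsemigroup generated by $n$ elements exists and is equal to $2$. -/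

import Mathlib

/-- A Brauer graph on `X`: a graph in which every vertex has degree at most `1`, whose vertex set is
the disjoint union of an upper copy of `X` (the vertices `Sum.inl x`) and a lower copy of `X`
(the vertices `Sum.inr x`). The type `PartialBrauer X` is the partial Brauer monoid of `X`. -/
@[ext]
structure PartialBrauer (X : Type*) where
  /-- The underlying graph. -/
  graph : SimpleGraph (X ⊕ X)
  /-- Every vertex has degree at most `1`. -/
  degree_le_one : ∀ v : X ⊕ X, (graph.neighborSet v).Subsingleton

namespace PartialBrauer

/-- The vertices of a product graph are in three rows, in this order: upper, middle, lower. The map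
`topRows` puts a Brauer graph on the upper and middle rows. -/
def topRows (X : Type*) : X ⊕ X ↪ X ⊕ (X ⊕ X) :=
  Function.Embedding.sumMap (Function.Embedding.refl X) Function.Embedding.inl

/-- The map that puts a Brauer graph on the middle and lower rows of a product graph. -/
def bottomRows (X : Type*) : X ⊕ X ↪ X ⊕ (X ⊕ X) :=
  Function.Embedding.inr

/-- The inclusion of the upper and lower rows in the vertex set of a product graph. -/
def outerRows (X : Type*) : X ⊕ X ↪ X ⊕ (X ⊕ X) :=
  Function.Embedding.sumMap (Function.Embedding.refl X) Function.Embedding.inr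

/-- The product graph of two Brauer graphs: `a` is placed on top of `b`, and the lower row of `a`
is identified with the upper row of `b`. Only its connected components matter, so parallel edges
are merged. -/
def productGraph {X : Type*} (a b : PartialBrauer X) : SimpleGraph (X ⊕ (X ⊕ X)) :=
  a.graph.map (topRows X) ⊔ b.graph.map (bottomRows X)

/-- In a graph whose edges are covered by two symmetric relations of degree at most `1`, a connected
component contains at most two vertices that do not meet edges of both kinds. -/
theorem eq_of_reachable_ends {V : Type*} {E : Bool → V → V → Prop}
    (hs : ∀ c u v, E c u v → E c v u) (hf : ∀ c u v w, E c u v → E c u w → v = w)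
    {u v w : V} (hu : ∃ c, ∀ x, ¬ E c u x) (hv : ∃ c, ∀ x, ¬ E c v x) (hw : ∃ c, ∀ x, ¬ E c w x)
    (huv : Relation.ReflTransGen (fun x y => ∃ c, E c x y) u v)
    (huw : Relation.ReflTransGen (fun x y => ∃ c, E c x y) u w)
    (hne : u ≠ v) (hne' : u ≠ w) : v = w := by
  obtain ⟨c₀, hc₀⟩ := hu
  -- a state is a vertex together with the kind of the next edge to follow
  let R : V × Bool → V × Bool → Prop := fun s t => E s.2 s.1 t.1 ∧ t.2 = !s.2
  have hR : Relator.RightUnique R := by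
    rintro ⟨x, c⟩ ⟨y, d⟩ ⟨z, e⟩ ⟨h1, h2⟩ ⟨h3, h4⟩
    simp only at h1 h2 h3 h4
    rw [hf _ _ _ _ h1 h3, h2, h4]
  have key : ∀ z, Relation.ReflTransGen (fun x y => ∃ c, E c x y) u z →
      ∃ c, Relation.ReflTransGen R (u, !c₀) (z, c) := by
    intro z hz
    induction hz with
    | refl => exact ⟨_, .refl⟩
    | @tail y z _ hyz ih =>
      obtain ⟨c, hc⟩ := ih
      obtain ⟨d, hd⟩ := hyz
      by_cases hcd : d = c
      · subst hcd
        exact ⟨!d, hc.tail ⟨hd, rfl⟩⟩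
      · have hd' : d = !c := by cases c <;> cases d <;> simp_all
        subst hd'
        rcases Relation.ReflTransGen.cases_tail hc with h | ⟨⟨x, e⟩, hx, h1, h2⟩
        · simp only [Prod.mk.injEq] at h
          obtain ⟨rfl, rfl⟩ := h
          simp only [Bool.not_not] at hd
          exact absurd hd (hc₀ _)
        · simp only at h1 h2
          subst h2
          simp only [Bool.not_not] at hd
          have := hf _ _ _ _ (hs _ _ _ h1) hd
          subst this
          exact ⟨e, hx⟩
  have term : ∀ z, u ≠ z → (∃ c, ∀ x, ¬ E c z x) → ∀ c,
      Relation.ReflTransGen R (u, !c₀) (z, c) → ∀ t, ¬ R (z, c) t := by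
    rintro z hz ⟨d, hd⟩ c hc t ⟨h1, -⟩
    rcases Relation.ReflTransGen.cases_tail hc with h | ⟨⟨x, e⟩, hx, h2, h3⟩
    · simp only [Prod.mk.injEq] at h
      exact hz h.1.symm
    · simp only at h1 h2 h3
      have h4 := hs _ _ _ h2
      subst h3
      rcases Bool.eq_or_eq_not d e with h | h
      · subst h; exact hd _ h4
      · subst h; exact hd _ h1
  obtain ⟨c, hc⟩ := key v huv
  obtain ⟨d, hd⟩ := key w huw
  rcases Relation.ReflTransGen.total_of_right_unique hR hc hd with h | h
  · rcases Relation.ReflTransGen.cases_head h with h | ⟨t, ht, -⟩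
    · exact congrArg Prod.fst h
    · exact absurd ht (term v hne hv c hc t)
  · rcases Relation.ReflTransGen.cases_head h with h | ⟨t, ht, -⟩
    · exact (congrArg Prod.fst h).symm
    · exact absurd ht (term w hne' hw d hd t)

theorem productGraph_adj {X : Type*} (a b : PartialBrauer X) (u v : X ⊕ (X ⊕ X)) :
    (productGraph a b).Adj u v ↔ (Relation.Map a.graph.Adj (topRows X) (topRows X) u v ∨
      Relation.Map b.graph.Adj (bottomRows X) (bottomRows X) u v) := by
  simp only [productGraph, SimpleGraph.sup_adj, SimpleGraph.map_adj, Relation.Map]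

/-- The product of two Brauer graphs: its edges join the distinct vertices in the upper and lower
rows that belong to the same connected component of the product graph. -/
instance instMul (X : Type*) : Mul (PartialBrauer X) where
  mul a b :=
    { graph :=
        { Adj := fun u v => u ≠ v ∧ (productGraph a b).Reachable (outerRows X u) (outerRows X v)
          symm := ⟨fun _ _ h => ⟨h.1.symm, h.2.symm⟩⟩
          loopless := ⟨fun _ h => h.1 rfl⟩ }
      degree_le_one := by
        rintro u v ⟨huv, hv⟩ w ⟨huw, hw⟩
        rw [SimpleGraph.reachable_iff_reflTransGen] at hv hw
        let E : Bool → X ⊕ (X ⊕ X) → X ⊕ (X ⊕ X) → Prop := fun c x y =>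
          bif c then Relation.Map a.graph.Adj (topRows X) (topRows X) x y
          else Relation.Map b.graph.Adj (bottomRows X) (bottomRows X) x y
        have hE : (productGraph a b).Adj = fun x y => ∃ c, E c x y := by
          funext x y
          simp [productGraph_adj, E, or_comm]
        rw [hE] at hv hw
        have hend : ∀ z, ∃ c, ∀ x, ¬ E c (outerRows X z) x := by
          rintro (z | z)
          · refine ⟨false, ?_⟩
            rintro x ⟨p, q, -, hp, -⟩
            simp [outerRows, bottomRows] at hp
          · refine ⟨true, ?_⟩
            rintro x ⟨p, q, -, hp, -⟩
            rcases p with p | p <;> simp [outerRows, topRows] at hp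
        refine (outerRows X).injective (eq_of_reachable_ends (E := E) ?_ ?_ (hend u) (hend v)
          (hend w) hv hw (fun h => huv ((outerRows X).injective h))
          (fun h => huw ((outerRows X).injective h)))
        · rintro (_ | _) x y ⟨p, q, h, hp, hq⟩ <;> exact ⟨q, p, h.symm, hq, hp⟩
        · rintro (_ | _) x y z ⟨p, q, h, hp, hq⟩ ⟨p', q', h', hp', hq'⟩
          · have := (bottomRows X).injective (hp.trans hp'.symm)
            subst this
            rw [← hq, ← hq', b.degree_le_one p h h']
          · have := (topRows X).injective (hp.trans hp'.symm)
            subst this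
            rw [← hq, ← hq', a.degree_le_one p h h'] }

/-- The identity: its edges join the two copies of each element of `X`. -/
instance instOne (X : Type*) : One (PartialBrauer X) where
  one :=
    { graph :=
        { Adj := fun u v => v = u.swap
          symm := ⟨fun u v h => by simp [h]⟩
          loopless := ⟨fun u h => by cases u <;> simp at h⟩ }
      degree_le_one := fun _ _ h _ h' => Eq.trans (Eq.trans h rfl) (Eq.symm h') }

theorem one_adj {X : Type*} (u v : X ⊕ X) : (1 : PartialBrauer X).graph.Adj u v ↔ v = u.swap :=
  Iff.rfl

theorem mul_adj {X : Type*} (a b : PartialBrauer X) (u v : X ⊕ X) :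
    (a * b).graph.Adj u v ↔ u ≠ v ∧ Relation.ReflTransGen (productGraph a b).Adj
      (outerRows X u) (outerRows X v) := by
  rw [← SimpleGraph.reachable_iff_reflTransGen]
  exact Iff.rfl

theorem reflTransGen_map_iff {V W : Type*} {r : V → V → Prop} {f : V → W}
    (hf : Function.Injective f) (a b : V) :
    Relation.ReflTransGen (Relation.Map r f f) (f a) (f b) ↔ Relation.ReflTransGen r a b := by
  constructor
  · intro h
    have : ∀ y, Relation.ReflTransGen (Relation.Map r f f) (f a) y →
        ∃ b, f b = y ∧ Relation.ReflTransGen r a b := by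
      intro y hy
      induction hy with
      | refl => exact ⟨a, rfl, .refl⟩
      | tail _ h ih =>
        obtain ⟨b, rfl, hb⟩ := ih
        obtain ⟨p, q, hpq, hp, rfl⟩ := h
        have := hf hp
        subst this
        exact ⟨q, rfl, hb.tail hpq⟩
    obtain ⟨b', hb', h'⟩ := this _ h
    exact hf hb' ▸ h'
  · intro h
    exact h.lift f fun x y hxy => ⟨x, y, hxy, rfl, rfl⟩

/-- In a larger graph that contains a product graph, the product graph may be replaced by the
product, as long as the rest of the graph does not meet the middle row. -/
theorem reflTransGen_mul_iff {X V : Type*} (a b : PartialBrauer X) {e : X ⊕ (X ⊕ X) → V}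
    (he : Function.Injective e) {B : V → V → Prop}
    (hB : ∀ x y, B x y → ∀ z, x ≠ e (.inr (.inl z)) ∧ y ≠ e (.inr (.inl z))) {u v : V}
    (hu : ∀ z, u ≠ e (.inr (.inl z))) (hv : ∀ z, v ≠ e (.inr (.inl z))) :
    Relation.ReflTransGen (fun x y => Relation.Map (a * b).graph.Adj
        (e ∘ outerRows X) (e ∘ outerRows X) x y ∨ B x y) u v ↔
      Relation.ReflTransGen (fun x y => Relation.Map (productGraph a b).Adj e e x y ∨ B x y)
        u v := by
  constructor
  · intro h
    induction h using Relation.ReflTransGen.trans_induction_on with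
    | refl => exact .refl
    | @single x y h =>
      rcases h with ⟨p, q, hpq, rfl, rfl⟩ | h
      · have := ((mul_adj a b p q).1 hpq).2
        exact Relation.ReflTransGen.mono (fun _ _ h => Or.inl h) _ _
          ((reflTransGen_map_iff he _ _).2 this)
      · exact .single (Or.inr h)
    | @trans x y z h1 h2 ih1 ih2 =>
      have hy : ∀ t, y ≠ e (.inr (.inl t)) := by
        rcases Relation.ReflTransGen.cases_tail h1 with rfl | ⟨w, -, h | h⟩
        · exact hu
        · obtain ⟨p, q, -, -, rfl⟩ := h
          intro t ht
          have := he ht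
          rcases q with q | q <;> simp [outerRows] at this
        · exact fun t => (hB _ _ h t).2
      exact (ih1 hu hy).trans (ih2 hy hv)
  · intro h
    set A := Relation.Map (productGraph a b).Adj e e with hA
    have outer : ∀ p : X ⊕ (X ⊕ X), (∀ z, e p ≠ e (.inr (.inl z))) → ∃ p', outerRows X p' = p := by
      rintro (p | p | p) hp
      · exact ⟨.inl p, rfl⟩
      · exact absurd rfl (hp p)
      · exact ⟨.inr p, rfl⟩
    have close : ∀ w z, (∀ t, w ≠ e (.inr (.inl t))) → (∀ t, z ≠ e (.inr (.inl t))) →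
        Relation.ReflTransGen A w z → Relation.ReflTransGen (fun x y =>
          Relation.Map (a * b).graph.Adj (e ∘ outerRows X) (e ∘ outerRows X) x y ∨ B x y) w z := by
      intro w z hw hz hwz
      by_cases hne : w = z
      · subst hne; exact .refl
      have h1 : ∃ p, e p = w := by
        rcases Relation.ReflTransGen.cases_head hwz with h | ⟨_, ⟨p, q, -, hp, -⟩, -⟩
        · exact absurd h hne
        · exact ⟨p, hp⟩
      have h2 : ∃ p, e p = z := by
        rcases Relation.ReflTransGen.cases_tail hwz with h | ⟨_, -, ⟨p, q, -, -, hq⟩⟩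
        · exact absurd h.symm hne
        · exact ⟨q, hq⟩
      obtain ⟨p, rfl⟩ := h1
      obtain ⟨q, rfl⟩ := h2
      obtain ⟨p, rfl⟩ := outer p hw
      obtain ⟨q, rfl⟩ := outer q hz
      refine .single (Or.inl ⟨p, q, (mul_adj a b p q).2 ⟨fun h => hne (by rw [h]), ?_⟩, rfl, rfl⟩)
      exact (reflTransGen_map_iff he _ _).1 hwz
    have key : ∀ z, Relation.ReflTransGen (fun x y => A x y ∨ B x y) u z →
        ∃ w, (∀ t, w ≠ e (.inr (.inl t))) ∧ Relation.ReflTransGen (fun x y =>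
          Relation.Map (a * b).graph.Adj (e ∘ outerRows X) (e ∘ outerRows X) x y ∨ B x y) u w ∧
          Relation.ReflTransGen A w z := by
      intro z hz
      induction hz with
      | refl => exact ⟨u, hu, .refl, .refl⟩
      | tail _ h ih =>
        obtain ⟨w, hw, h1, h2⟩ := ih
        rcases h with h | h
        · exact ⟨w, hw, h1, h2.tail h⟩
        · exact ⟨_, fun t => (hB _ _ h t).2,
            (h1.trans (close _ _ hw (fun t => (hB _ _ h t).1) h2)).tail (Or.inr h), .refl⟩
    obtain ⟨w, hw, h1, h2⟩ := key v h
    exact h1.trans (close _ _ hw hv h2)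

theorem map_map_eq {U V W : Type*} (r : U → U → Prop) (f : U → V) (g : V → W) :
    Relation.Map (Relation.Map r f f) g g = Relation.Map r (g ∘ f) (g ∘ f) := by
  exact Relation.map_map r f f g g

theorem map_productGraph {X V : Type*} (a b : PartialBrauer X) (e : X ⊕ (X ⊕ X) → V) (x y : V) :
    Relation.Map (productGraph a b).Adj e e x y ↔
      (Relation.Map a.graph.Adj (e ∘ topRows X) (e ∘ topRows X) x y ∨
        Relation.Map b.graph.Adj (e ∘ bottomRows X) (e ∘ bottomRows X) x y) := by
  rw [← map_map_eq, ← map_map_eq]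
  constructor
  · rintro ⟨p, q, h, hp, hq⟩
    rcases (productGraph_adj a b p q).1 h with h | h
    · exact Or.inl ⟨p, q, h, hp, hq⟩
    · exact Or.inr ⟨p, q, h, hp, hq⟩
  · rintro (⟨p, q, h, hp, hq⟩ | ⟨p, q, h, hp, hq⟩)
    · exact ⟨p, q, (productGraph_adj a b p q).2 (Or.inl h), hp, hq⟩
    · exact ⟨p, q, (productGraph_adj a b p q).2 (Or.inr h), hp, hq⟩

protected theorem mul_assoc {X : Type*} (a b c : PartialBrauer X) : a * b * c = a * (b * c) := by
  -- four rows, and the inclusions of two or three of them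
  let r12 : X ⊕ X → X ⊕ (X ⊕ (X ⊕ X)) := Sum.elim .inl (.inr ∘ .inl)
  let r23 : X ⊕ X → X ⊕ (X ⊕ (X ⊕ X)) := Sum.elim (.inr ∘ .inl) (.inr ∘ .inr ∘ .inl)
  let r34 : X ⊕ X → X ⊕ (X ⊕ (X ⊕ X)) := Sum.elim (.inr ∘ .inr ∘ .inl) (.inr ∘ .inr ∘ .inr)
  let r14 : X ⊕ X → X ⊕ (X ⊕ (X ⊕ X)) := Sum.elim .inl (.inr ∘ .inr ∘ .inr)
  let r123 : X ⊕ (X ⊕ X) → X ⊕ (X ⊕ (X ⊕ X)) := Sum.elim .inl r23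
  let r234 : X ⊕ (X ⊕ X) → X ⊕ (X ⊕ (X ⊕ X)) := .inr
  let r134 : X ⊕ (X ⊕ X) → X ⊕ (X ⊕ (X ⊕ X)) := Sum.elim .inl r34
  let r124 : X ⊕ (X ⊕ X) → X ⊕ (X ⊕ (X ⊕ X)) :=
    Sum.elim .inl (Sum.elim (.inr ∘ .inl) (.inr ∘ .inr ∘ .inr))
  have i123 : Function.Injective r123 := by
    rintro (x | x | x) (y | y | y) h <;> simp_all [r123, r23]
  have i134 : Function.Injective r134 := by
    rintro (x | x | x) (y | y | y) h <;> simp_all [r134, r34]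
  have i124 : Function.Injective r124 := by
    rintro (x | x | x) (y | y | y) h <;> simp_all [r124]
  have i234 : Function.Injective r234 := Sum.inr_injective
  have e1 : r123 ∘ topRows X = r12 := by funext x; rcases x with x | x <;> rfl
  have e2 : r123 ∘ bottomRows X = r23 := by funext x; rcases x with x | x <;> rfl
  have e3 : r123 ∘ outerRows X = r134 ∘ topRows X := by funext x; rcases x with x | x <;> rfl
  have e4 : r134 ∘ bottomRows X = r34 := by funext x; rcases x with x | x <;> rfl
  have e5 : r134 ∘ outerRows X = r14 := by funext x; rcases x with x | x <;> rfl
  have f1 : r234 ∘ topRows X = r23 := by funext x; rcases x with x | x <;> rfl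
  have f2 : r234 ∘ bottomRows X = r34 := by funext x; rcases x with x | x <;> rfl
  have f3 : r234 ∘ outerRows X = r124 ∘ bottomRows X := by funext x; rcases x with x | x <;> rfl
  have f4 : r124 ∘ topRows X = r12 := by funext x; rcases x with x | x <;> rfl
  have f5 : r124 ∘ outerRows X = r14 := by funext x; rcases x with x | x <;> rfl
  let M (d : PartialBrauer X) (r : X ⊕ X → X ⊕ (X ⊕ (X ⊕ X))) := Relation.Map d.graph.Adj r r
  have L : ∀ u v, Relation.ReflTransGen (productGraph (a * b) c).Adj
      (outerRows X u) (outerRows X v) ↔ Relation.ReflTransGen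
        (fun x y => (M a r12 x y ∨ M b r23 x y) ∨ M c r34 x y) (r14 u) (r14 v) := by
    intro u v
    rw [← reflTransGen_map_iff i134, ← Function.comp_apply (f := r134),
      ← Function.comp_apply (f := r134), e5]
    have h1 : Relation.Map (productGraph (a * b) c).Adj r134 r134 =
        fun x y => Relation.Map (a * b).graph.Adj (r123 ∘ outerRows X) (r123 ∘ outerRows X) x y ∨
          M c r34 x y := by
      funext x y
      rw [eq_iff_iff, map_productGraph, e3, e4]
    have h2 : (fun x y => (M a r12 x y ∨ M b r23 x y) ∨ M c r34 x y) =
        fun x y => Relation.Map (productGraph a b).Adj r123 r123 x y ∨ M c r34 x y := by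
      funext x y
      rw [eq_iff_iff, map_productGraph, e1, e2]
    rw [h1, h2]
    refine reflTransGen_mul_iff a b i123 ?_ ?_ ?_
    · rintro _ _ ⟨p, q, -, rfl, rfl⟩ z
      rcases p with p | p <;> rcases q with q | q <;> simp [r123, r34, r23]
    · rcases u with u | u <;> simp [r14, r123, r23]
    · rcases v with u | u <;> simp [r14, r123, r23]
  have R : ∀ u v, Relation.ReflTransGen (productGraph a (b * c)).Adj
      (outerRows X u) (outerRows X v) ↔ Relation.ReflTransGen
        (fun x y => (M b r23 x y ∨ M c r34 x y) ∨ M a r12 x y) (r14 u) (r14 v) := by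
    intro u v
    rw [← reflTransGen_map_iff i124, ← Function.comp_apply (f := r124),
      ← Function.comp_apply (f := r124), f5]
    have h1 : Relation.Map (productGraph a (b * c)).Adj r124 r124 =
        fun x y => Relation.Map (b * c).graph.Adj (r234 ∘ outerRows X) (r234 ∘ outerRows X) x y ∨
          M a r12 x y := by
      funext x y
      rw [eq_iff_iff, map_productGraph, f3, f4, or_comm]
    have h2 : (fun x y => (M b r23 x y ∨ M c r34 x y) ∨ M a r12 x y) =
        fun x y => Relation.Map (productGraph b c).Adj r234 r234 x y ∨ M a r12 x y := by
      funext x y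
      rw [eq_iff_iff, map_productGraph, f1, f2]
    rw [h1, h2]
    refine reflTransGen_mul_iff b c i234 ?_ ?_ ?_
    · rintro _ _ ⟨p, q, -, rfl, rfl⟩ z
      rcases p with p | p <;> rcases q with q | q <;> simp [r12, r234]
    · rcases u with u | u <;> simp [r14, r234]
    · rcases v with u | u <;> simp [r14, r234]
  ext u v
  rw [mul_adj, mul_adj, L, R]
  have : (fun x y => (M a r12 x y ∨ M b r23 x y) ∨ M c r34 x y) =
      fun x y => (M b r23 x y ∨ M c r34 x y) ∨ M a r12 x y := by
    funext x y
    rw [eq_iff_iff]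
    tauto
  rw [this]

theorem adj_of_reflTransGen {X : Type*} (a : PartialBrauer X) {u v : X ⊕ X}
    (h : Relation.ReflTransGen a.graph.Adj u v) : u = v ∨ a.graph.Adj u v := by
  induction h with
  | refl => exact Or.inl rfl
  | tail _ h ih =>
    rcases ih with rfl | ih
    · exact Or.inr h
    · exact Or.inl (a.degree_le_one _ ih.symm h)

theorem reflTransGen_of_collapse {X V : Type*} (a : PartialBrauer X) {r : V → V → Prop}
    (f : V → X ⊕ X) (hf : ∀ x y, r x y → f x = f y ∨ a.graph.Adj (f x) (f y)) {x y : V}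
    (h : Relation.ReflTransGen r x y) : Relation.ReflTransGen a.graph.Adj (f x) (f y) := by
  induction h with
  | refl => exact .refl
  | tail _ h ih =>
    rcases hf _ _ h with h | h
    · exact h ▸ ih
    · exact ih.tail h

protected theorem one_mul {X : Type*} (a : PartialBrauer X) : 1 * a = a := by
  ext u v
  rw [mul_adj]
  constructor
  · rintro ⟨hne, h⟩
    have := reflTransGen_of_collapse a (Sum.elim Sum.inl id : X ⊕ (X ⊕ X) → X ⊕ X) ?_ h
    · have e : ∀ w, (Sum.elim Sum.inl id : X ⊕ (X ⊕ X) → X ⊕ X) (outerRows X w) = w := by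
        rintro (w | w) <;> rfl
      rw [e, e] at this
      exact (adj_of_reflTransGen a this).resolve_left hne
    · intro x y hxy
      rcases (productGraph_adj _ _ _ _).1 hxy with ⟨p, q, h, rfl, rfl⟩ | ⟨p, q, h, rfl, rfl⟩
      · rw [one_adj] at h
        subst h
        rcases p with p | p <;> exact Or.inl rfl
      · exact Or.inr h
  · intro h
    refine ⟨h.ne, ?_⟩
    have h1 : ∀ w, Relation.ReflTransGen (productGraph 1 a).Adj (outerRows X w)
        (bottomRows X w) := by
      rintro (w | w)
      · refine .single ((productGraph_adj _ _ _ _).2 (Or.inl ⟨.inl w, .inr w, ?_, rfl, rfl⟩))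
        exact (one_adj _ _).2 rfl
      · exact .refl
    have h2 : ∀ w, Relation.ReflTransGen (productGraph 1 a).Adj (bottomRows X w)
        (outerRows X w) := by
      rintro (w | w)
      · refine .single ((productGraph_adj _ _ _ _).2 (Or.inl ⟨.inr w, .inl w, ?_, rfl, rfl⟩))
        exact (one_adj _ _).2 rfl
      · exact .refl
    exact ((h1 u).tail ((productGraph_adj _ _ _ _).2 (Or.inr ⟨u, v, h, rfl, rfl⟩))).trans (h2 v)

protected theorem mul_one {X : Type*} (a : PartialBrauer X) : a * 1 = a := by
  ext u v
  rw [mul_adj]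
  constructor
  · rintro ⟨hne, h⟩
    have := reflTransGen_of_collapse a
      (Sum.elim Sum.inl (Sum.elim Sum.inr Sum.inr) : X ⊕ (X ⊕ X) → X ⊕ X) ?_ h
    · have e : ∀ w, (Sum.elim Sum.inl (Sum.elim Sum.inr Sum.inr) : X ⊕ (X ⊕ X) → X ⊕ X)
          (outerRows X w) = w := by
        rintro (w | w) <;> rfl
      rw [e, e] at this
      exact (adj_of_reflTransGen a this).resolve_left hne
    · intro x y hxy
      rcases (productGraph_adj _ _ _ _).1 hxy with ⟨p, q, h, rfl, rfl⟩ | ⟨p, q, h, rfl, rfl⟩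
      · refine Or.inr ?_
        rcases p with p | p <;> rcases q with q | q <;> exact h
      · rw [one_adj] at h
        subst h
        rcases p with p | p <;> exact Or.inl rfl
  · intro h
    refine ⟨h.ne, ?_⟩
    have h1 : ∀ w, Relation.ReflTransGen (productGraph a 1).Adj (outerRows X w)
        (topRows X w) := by
      rintro (w | w)
      · exact .refl
      · refine .single ((productGraph_adj _ _ _ _).2 (Or.inr ⟨.inr w, .inl w, ?_, rfl, rfl⟩))
        exact (one_adj _ _).2 rfl
    have h2 : ∀ w, Relation.ReflTransGen (productGraph a 1).Adj (topRows X w)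
        (outerRows X w) := by
      rintro (w | w)
      · exact .refl
      · refine .single ((productGraph_adj _ _ _ _).2 (Or.inr ⟨.inl w, .inr w, ?_, rfl, rfl⟩))
        exact (one_adj _ _).2 rfl
    exact ((h1 u).tail ((productGraph_adj _ _ _ _).2 (Or.inl ⟨u, v, h, rfl, rfl⟩))).trans (h2 v)

/-- The partial Brauer monoid of `X`. -/
instance instMonoid (X : Type*) : Monoid (PartialBrauer X) where
  mul_assoc := PartialBrauer.mul_assoc
  one_mul := PartialBrauer.one_mul
  mul_one := PartialBrauer.mul_one

end PartialBrauer

/-- `IsProductOfLength U n s`: the element `s` is a product `u₁ u₂ ⋯ uₙ` of `n ≥ 1` factors, all of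
them in `U`. -/
inductive IsProductOfLength {S : Type*} [Semigroup S] (U : Set S) : ℕ → S → Prop
  | of_mem {u : S} (hu : u ∈ U) : IsProductOfLength U 1 u
  | mul_mem {n : ℕ} {s u : S} (hs : IsProductOfLength U n s) (hu : u ∈ U) :
      IsProductOfLength U (n + 1) (s * u)

/-- The semigroup Bergman property: every generating set has a bounded length function, where the
length of an element is the least number of factors in an expression of the element as a product
of generators. -/
def SemigroupBergmanProperty (S : Type*) [Semigroup S] : Prop :=
  ∀ U : Set S, Subsemigroup.closure U = ⊤ → ∃ N : ℕ, ∀ s : S, ∃ n ≤ N, IsProductOfLength U n s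

/-- The Sierpiński rank: the least natural number `n` such that every countable subset of the
semigroup is contained in a subsemigroup generated by at most `n` elements; it is infinite (`⊤`) if
there is no such `n`. -/
noncomputable def sierpinskiRank (S : Type*) [Semigroup S] : ℕ∞ :=
  ⨅ (n : ℕ) (_ : ∀ C : Set S, C.Countable →
    ∃ U : Finset S, U.card ≤ n ∧ C ⊆ Subsemigroup.closure (U : Set S)), (n : ℕ∞)

/-! Both claims follow from strong distortion: any sequence of elements lies in a subsemigroup
generated by two elements, the length of the `n`th term being bounded independently of the sequence
(`stronglyTwoDistorted`). A diagonal argument then gives the Bergman property. The rank is at most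
`2` at once, and it is not smaller since a subsemigroup with one generator is commutative and the
monoid is not.

For the distortion, split `X` into four blocks, each a copy of `X`. Fix `a`, which attaches the
upper row to block `0` and carries edges inside block `2`, and `D`, which attaches block `0` to the
lower row and carries edges inside block `3`. Indexing these edges by pairs of points provides an
edge for every pair that an arbitrary Brauer graph may join within a row, and diagonal pairs give
isolated vertices. Hence every Brauer graph is `a * ofPerm g * D` for some permutation `g`
(`insertion_mul_ofPerm_mul_projection`), and `g` can be an involution followed by a fixed
permutation of blocks (`exists_perm_of_involutive`).

The involutions of the whole sequence are packed into one involution `e`, acting on nested copies of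
`X`. If `g` preserves block `0`, then `a * ofPerm g * D` is its action there; for `e` this deletes
the first term of the sequence. Finally `e` and the needed block permutations are packed into one
permutation of order dividing `6`, which is absorbed into the second generator. -/

namespace PartialBrauer

/-! ### Brauer graphs as involutions, and permutations as Brauer graphs -/

variable {X : Type*}

/-- The Brauer graph whose edges join each vertex to its image under an involution. -/
def ofInvolutive (p : X ⊕ X → X ⊕ X) (hp : Function.Involutive p) : PartialBrauer X where
  graph :=
    { Adj := fun u v => u ≠ v ∧ p u = v
      symm := ⟨fun u v h => ⟨h.1.symm, by rw [← h.2, hp]⟩⟩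
      loopless := ⟨fun _ h => h.1 rfl⟩ }
  degree_le_one := fun _ _ h _ h' => h.2.symm.trans h'.2

theorem ofInvolutive_adj {p : X ⊕ X → X ⊕ X} {hp : Function.Involutive p} {u v : X ⊕ X} :
    (ofInvolutive p hp).graph.Adj u v ↔ u ≠ v ∧ p u = v :=
  Iff.rfl

open Classical in
theorem exists_eq_ofInvolutive (s : PartialBrauer X) : ∃ p hp, s = ofInvolutive p hp := by
  -- The default value `u` makes the isolated vertices the fixed points of `p`.
  let p : X ⊕ X → X ⊕ X := fun u => if h : ∃ v, s.graph.Adj u v then h.choose else u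
  have h1 : ∀ u v, s.graph.Adj u v → p u = v := by
    intro u v h
    have h' : ∃ v, s.graph.Adj u v := ⟨v, h⟩
    simp only [p, dif_pos h']
    exact s.degree_le_one u h'.choose_spec h
  have h2 : ∀ u, p u = u ∨ s.graph.Adj u (p u) := by
    intro u
    by_cases h' : ∃ v, s.graph.Adj u v
    · exact Or.inr (by simpa only [p, dif_pos h'] using h'.choose_spec)
    · exact Or.inl (by simp only [p, dif_neg h'])
  have hp : Function.Involutive p := by
    intro u
    rcases h2 u with h | h
    · rw [h, h]
    · exact h1 _ _ h.symm
  refine ⟨p, hp, ?_⟩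
  ext u v
  rw [ofInvolutive_adj]
  constructor
  · exact fun h => ⟨h.ne, h1 _ _ h⟩
  · rintro ⟨hne, rfl⟩
    exact (h2 u).resolve_left (Ne.symm hne)

/-- To identify a product it is enough to label the vertices of the product graph in such a way that
labels are constant, up to edges of the expected product, along edges. -/
theorem mul_eq_of_label {a b s : PartialBrauer X} (c : X ⊕ (X ⊕ X) → Option (X ⊕ X))
    (hc : ∀ u, c (outerRows X u) = some u)
    (ha : ∀ u v, a.graph.Adj u v → c (topRows X u) = c (topRows X v) ∨
      ∃ p q, c (topRows X u) = some p ∧ c (topRows X v) = some q ∧ s.graph.Adj p q)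
    (hb : ∀ u v, b.graph.Adj u v → c (bottomRows X u) = c (bottomRows X v) ∨
      ∃ p q, c (bottomRows X u) = some p ∧ c (bottomRows X v) = some q ∧ s.graph.Adj p q)
    (hs : ∀ u v, s.graph.Adj u v →
      Relation.ReflTransGen (productGraph a b).Adj (outerRows X u) (outerRows X v)) :
    a * b = s := by
  ext u v
  rw [mul_adj]
  refine ⟨fun ⟨hne, h⟩ => ?_, fun h => ⟨h.ne, hs u v h⟩⟩
  -- A walk that starts in an outer row never meets the label `none`, which is left for components
  -- inside the middle row.
  have key : ∀ y, Relation.ReflTransGen (productGraph a b).Adj (outerRows X u) y →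
      ∃ q, c y = some q ∧ Relation.ReflTransGen s.graph.Adj u q := by
    intro y hy
    induction hy with
    | refl => exact ⟨u, hc u, .refl⟩
    | @tail y z _ hyz ih =>
      obtain ⟨q, hq, h⟩ := ih
      have : c y = c z ∨ ∃ p q, c y = some p ∧ c z = some q ∧ s.graph.Adj p q := by
        rcases (productGraph_adj _ _ _ _).1 hyz with ⟨k, l, hkl, rfl, rfl⟩ | ⟨k, l, hkl, rfl, rfl⟩
        · exact ha _ _ hkl
        · exact hb _ _ hkl
      rcases this with h' | ⟨p, r, h1, h2, h3⟩
      · exact ⟨q, h' ▸ hq, h⟩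
      · obtain rfl : q = p := Option.some.inj (hq.symm.trans h1)
        exact ⟨r, h2, h.tail h3⟩
  obtain ⟨q, hq, h'⟩ := key _ h
  obtain rfl : v = q := Option.some.inj ((hc v).symm.trans hq)
  exact (adj_of_reflTransGen s h').resolve_left hne

theorem productGraph_adj_top {a b : PartialBrauer X} {u v : X ⊕ X} (h : a.graph.Adj u v) :
    (productGraph a b).Adj (topRows X u) (topRows X v) :=
  (productGraph_adj _ _ _ _).2 (Or.inl ⟨u, v, h, rfl, rfl⟩)

theorem productGraph_adj_bottom {a b : PartialBrauer X} {u v : X ⊕ X} (h : b.graph.Adj u v) :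
    (productGraph a b).Adj (bottomRows X u) (bottomRows X v) :=
  (productGraph_adj _ _ _ _).2 (Or.inr ⟨u, v, h, rfl, rfl⟩)

theorem involutive_sumElim (g : Equiv.Perm X) :
    Function.Involutive (Sum.elim (Sum.inr ∘ g) (Sum.inl ∘ g.symm) : X ⊕ X → X ⊕ X) := by
  rintro (x | x) <;> simp

/-- The Brauer graph of a permutation: its edges join each upper vertex to the lower copy of its
image. -/
def ofPerm (g : Equiv.Perm X) : PartialBrauer X :=
  ofInvolutive (Sum.elim (Sum.inr ∘ g) (Sum.inl ∘ g.symm)) (involutive_sumElim g)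

theorem ofPerm_adj {g : Equiv.Perm X} {x y : X} :
    (ofPerm g).graph.Adj (Sum.inl x) (Sum.inr y) ↔ g x = y := by
  rw [ofPerm, ofInvolutive_adj]
  simp

theorem ofPerm_adj_inl_inl {g : Equiv.Perm X} {x y : X} :
    ¬ (ofPerm g).graph.Adj (Sum.inl x) (Sum.inl y) := by
  rw [ofPerm, ofInvolutive_adj]
  simp

theorem ofPerm_adj_inr_inr {g : Equiv.Perm X} {x y : X} :
    ¬ (ofPerm g).graph.Adj (Sum.inr x) (Sum.inr y) := by
  rw [ofPerm, ofInvolutive_adj]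
  simp

theorem ofPerm_injective : Function.Injective (ofPerm (X := X)) := by
  intro g h hgh
  ext x
  have : (ofPerm g).graph.Adj (Sum.inl x) (Sum.inr (g x)) := ofPerm_adj.2 rfl
  rw [hgh] at this
  exact (ofPerm_adj.1 this).symm

/-- Relabelling the upper row of a Brauer graph along a permutation. -/
def relabelTop (g : Equiv.Perm X) (b : PartialBrauer X) : PartialBrauer X where
  graph := b.graph.comap (Sum.map g id)
  degree_le_one := fun _ _ h _ h' =>
    (g.injective.sumMap Function.injective_id) (b.degree_le_one _ h h')

theorem relabelTop_adj {g : Equiv.Perm X} {b : PartialBrauer X} {u v : X ⊕ X} :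
    (relabelTop g b).graph.Adj u v ↔ b.graph.Adj (Sum.map g id u) (Sum.map g id v) :=
  Iff.rfl

/-- Each middle vertex hangs on exactly one upper vertex, so contracting the edges of `ofPerm g`
only renames the upper row of `b`. -/
theorem ofPerm_mul_eq_relabelTop (g : Equiv.Perm X) (b : PartialBrauer X) :
    ofPerm g * b = relabelTop g b := by
  have hup : ∀ u, Relation.ReflTransGen (productGraph (ofPerm g) b).Adj (outerRows X u)
      (bottomRows X (Sum.map g id u)) := by
    rintro (u | u)
    · exact .single (productGraph_adj_top (u := Sum.inl u) (v := Sum.inr (g u)) (ofPerm_adj.2 rfl))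
    · exact .refl
  have hdown : ∀ u, Relation.ReflTransGen (productGraph (ofPerm g) b).Adj
      (bottomRows X (Sum.map g id u)) (outerRows X u) := by
    rintro (u | u)
    · exact .single (productGraph_adj_top (u := Sum.inr (g u)) (v := Sum.inl u)
        (ofPerm_adj.2 rfl).symm)
    · exact .refl
  refine mul_eq_of_label
    (Sum.elim (fun x => some (Sum.inl x)) (fun u => some (Sum.map g.symm id u))) ?_ ?_ ?_ ?_
  · rintro (u | u) <;> rfl
  · rintro (u | u) (v | v) h
    · exact absurd h ofPerm_adj_inl_inl
    · rw [ofPerm_adj] at h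
      subst h
      simp [topRows]
    · have h := h.symm
      rw [ofPerm_adj] at h
      subst h
      simp [topRows]
    · exact absurd h ofPerm_adj_inr_inr
  · intro u v h
    refine Or.inr ⟨_, _, rfl, rfl, ?_⟩
    rw [relabelTop_adj]
    have : ∀ w : X ⊕ X, Sum.map g id (Sum.map g.symm id w) = w := by rintro (w | w) <;> simp
    rwa [this, this]
  · intro u v h
    exact ((hup u).tail (productGraph_adj_bottom h)).trans (hdown v)

/-- The order is reversed because products are read from top to bottom, while permutations compose
from right to left. -/
theorem ofPerm_mul (g h : Equiv.Perm X) : ofPerm g * ofPerm h = ofPerm (h * g) := by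
  rw [ofPerm_mul_eq_relabelTop]
  ext u v
  rw [relabelTop_adj]
  rcases u with u | u <;> rcases v with v | v
  · exact iff_of_false ofPerm_adj_inl_inl ofPerm_adj_inl_inl
  · exact ofPerm_adj.trans (ofPerm_adj (g := h * g)).symm
  · rw [SimpleGraph.adj_comm, SimpleGraph.adj_comm (ofPerm (h * g)).graph]
    exact ofPerm_adj.trans (ofPerm_adj (g := h * g)).symm
  · exact iff_of_false ofPerm_adj_inr_inr ofPerm_adj_inr_inr

theorem ofPerm_one : ofPerm (1 : Equiv.Perm X) = 1 := by
  ext u v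
  rw [one_adj]
  rcases u with u | u <;> rcases v with v | v <;>
    rw [ofPerm, ofInvolutive_adj] <;> simp [eq_comm, ← Equiv.Perm.inv_def]

theorem ofPerm_pow (g : Equiv.Perm X) (n : ℕ) : ofPerm g ^ n = ofPerm (g ^ n) := by
  induction n with
  | zero => rw [pow_zero, pow_zero, ofPerm_one]
  | succ n ih => rw [pow_succ, ih, ofPerm_mul, pow_succ']

end PartialBrauer

/-! ### Encoding a Brauer graph by a permutation -/

namespace PartialBrauer

variable {X : Type*}

section Insertion

variable (E : X ≃ X × Fin 4) (q : X × X ≃ X) (i : Fin 4)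

/-- The involution that matches the upper row with block `0` of the lower row, and the points
`(a, b)` and `(b, a)` of block `i` of the lower row. -/
def insertionMap : X ⊕ X → X ⊕ X
  | .inl x => .inr (E.symm (x, 0))
  | .inr z => if (E z).2 = 0 then .inl (E z).1 else
      if (E z).2 = i then .inr (E.symm (q (q.symm (E z).1).swap, i)) else .inr z

theorem involutive_insertionMap : Function.Involutive (insertionMap E q i) := by
  rintro (x | z)
  · simp [insertionMap]
  · by_cases h0 : (E z).2 = 0
    · have : (((E z).1, 0) : X × Fin 4) = E z := by rw [← h0]
      simp [insertionMap, h0, this]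
    · by_cases hi : (E z).2 = i
      · have : (((E z).1, i) : X × Fin 4) = E z := by rw [← hi]
        have h0' : i ≠ 0 := hi ▸ h0
        simp [insertionMap, hi, this, h0']
      · simp [insertionMap, h0, hi]

/-- The Brauer graph that inserts `X` in block `0` of the lower row, with edges in block `i` of the
lower row. -/
def insertion : PartialBrauer X :=
  ofInvolutive (insertionMap E q i) (involutive_insertionMap E q i)

theorem involutive_swap_comp {p : X ⊕ X → X ⊕ X} (hp : Function.Involutive p) :
    Function.Involutive (Sum.swap ∘ p ∘ Sum.swap) := by
  intro u
  simp [hp (Sum.swap u)]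

/-- The Brauer graph `insertion`, turned upside down. -/
def projection : PartialBrauer X :=
  ofInvolutive _ (involutive_swap_comp (involutive_insertionMap E q i))

variable {E q i}

theorem projection_adj {u v : X ⊕ X} :
    (projection E q i).graph.Adj u v ↔ (insertion E q i).graph.Adj u.swap v.swap := by
  rw [projection, insertion, ofInvolutive_adj, ofInvolutive_adj]
  refine and_congr (not_congr Sum.swap_leftInverse.injective.eq_iff.symm) ?_
  simp only [Function.comp_apply]
  constructor
  · rintro rfl
    simp
  · intro h
    rw [h]
    simp

theorem insertion_adj_inl_inl {x y : X} :
    ¬ (insertion E q i).graph.Adj (Sum.inl x) (Sum.inl y) := by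
  rw [insertion, ofInvolutive_adj]
  simp [insertionMap]

theorem insertion_adj_inl_inr {x z : X} :
    (insertion E q i).graph.Adj (Sum.inl x) (Sum.inr z) ↔ E.symm (x, 0) = z := by
  rw [insertion, ofInvolutive_adj]
  simp [insertionMap]

/-- Diagonal points `(a, a)` are isolated; they later absorb the isolated vertices of a Brauer
graph. For `i = 0` the attachment to the upper row takes precedence and no such edges remain. -/
theorem insertion_adj_inr_inr {z w : X} :
    (insertion E q i).graph.Adj (Sum.inr z) (Sum.inr w) ↔ i ≠ 0 ∧ ∃ a b, a ≠ b ∧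
      E.symm (q (a, b), i) = z ∧ E.symm (q (b, a), i) = w := by
  rw [insertion, ofInvolutive_adj]
  constructor
  · rintro ⟨hne, h⟩
    simp only [insertionMap] at h
    split_ifs at h with h0 hi
    · rw [Sum.inr.injEq] at h
      have e : E.symm ((E z).1, i) = z := by rw [← hi]; simp
      refine ⟨hi ▸ h0, (q.symm (E z).1).1, (q.symm (E z).1).2, ?_, ?_, h⟩
      · intro he
        refine hne (congrArg _ ?_)
        have hs : (q.symm (E z).1).swap = q.symm (E z).1 := Prod.ext he.symm he
        rw [← h, hs]
        simpa using e.symm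
      · simpa using e
    · exact absurd h hne
  · rintro ⟨hi, a, b, hab, rfl, rfl⟩
    simp [insertionMap, hi, hab]

open Classical in
/-- Every Brauer graph can be written as a permutation between an insertion and a projection. -/
theorem insertion_mul_ofPerm_mul_projection {j : Fin 4} (hi : i ≠ 0) (hj : j ≠ 0)
    {p : X ⊕ X → X ⊕ X} (hp : Function.Involutive p) (g : Equiv.Perm X)
    (h1 : ∀ x y, p (Sum.inl x) = Sum.inr y → g (E.symm (x, 0)) = E.symm (y, 0))
    (h2 : ∀ x w, p (Sum.inl x) = Sum.inl w → g (E.symm (x, 0)) = E.symm (q (x, w), j))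
    (h3 : ∀ y w, p (Sum.inr y) = Sum.inr w → g (E.symm (q (y, w), i)) = E.symm (y, 0)) :
    insertion E q i * ofPerm g * projection E q j = ofInvolutive p hp := by
  rw [PartialBrauer.mul_assoc, ofPerm_mul_eq_relabelTop]
  set a := insertion E q i
  set b := relabelTop g (projection E q j)
  -- A middle point in block `0` hangs on an upper vertex; one outside it that `g` sends into block
  -- `0` hangs on a lower vertex. The others get `none`.
  let c : X ⊕ (X ⊕ X) → Option (X ⊕ X) := fun v => match v with
    | .inl x => some (.inl x)
    | .inr (.inl z) => if (E z).2 = 0 then some (.inl (E z).1) else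
        if (E (g z)).2 = 0 then some (.inr (E (g z)).1) else none
    | .inr (.inr y) => some (.inr y)
  have c0 : ∀ x, c (.inr (.inl (E.symm (x, 0)))) = some (.inl x) := by
    intro x; simp [c]
  have c1 : ∀ z y, (E z).2 ≠ 0 → g z = E.symm (y, 0) → c (.inr (.inl z)) = some (.inr y) := by
    intro z y hz hy; simp [c, hz, hy]
  have c2 : ∀ z, (E z).2 ≠ 0 → (E (g z)).2 ≠ 0 → c (.inr (.inl z)) = none := by
    intro z hz hy; simp [c, hz, hy]
  have zero : ∀ z, (E z).2 = 0 → ∃ x, z = E.symm (x, 0) := by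
    intro z hz
    exact ⟨(E z).1, by rw [← hz]; simp⟩
  have sadj : ∀ u v, u ≠ v → p u = v → (ofInvolutive p hp).graph.Adj u v :=
    fun u v h h' => ⟨h, h'⟩
  have atop : ∀ x, (productGraph a b).Adj (.inl x) (.inr (.inl (E.symm (x, 0)))) := fun x =>
    productGraph_adj_top (u := .inl x) (v := .inr (E.symm (x, 0))) (insertion_adj_inl_inr.2 rfl)
  have abot : ∀ y z, g z = E.symm (y, 0) →
      (productGraph a b).Adj (.inr (.inr y)) (.inr (.inl z)) := fun y z h =>
    productGraph_adj_bottom (u := .inr y) (v := .inl z)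
      (relabelTop_adj.2 (projection_adj.2 (insertion_adj_inl_inr.2 h.symm)))
  have ahook : ∀ x y, x ≠ y → (productGraph a b).Adj (.inr (.inl (E.symm (q (x, y), i))))
      (.inr (.inl (E.symm (q (y, x), i)))) := fun x y h =>
    productGraph_adj_top (u := .inr _) (v := .inr _)
      (insertion_adj_inr_inr.2 ⟨hi, x, y, h, rfl, rfl⟩)
  have bhook : ∀ x y z w, x ≠ y → g z = E.symm (q (x, y), j) → g w = E.symm (q (y, x), j) →
      (productGraph a b).Adj (.inr (.inl z)) (.inr (.inl w)) := fun x y z w h hz hw =>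
    productGraph_adj_bottom (u := .inl z) (v := .inl w)
      (relabelTop_adj.2 (projection_adj.2 (insertion_adj_inr_inr.2
        ⟨hj, x, y, h, hz.symm, hw.symm⟩)))
  refine mul_eq_of_label c ?_ ?_ ?_ ?_
  · rintro (u | u) <;> rfl
  · have inl_inr : ∀ x z, a.graph.Adj (.inl x) (.inr z) →
        c (topRows X (.inl x)) = c (topRows X (.inr z)) := by
      intro x z h
      rw [insertion_adj_inl_inr] at h
      subst h
      exact (c0 x).symm
    rintro (x | z) (y | w) h
    · exact absurd h insertion_adj_inl_inl
    · exact Or.inl (inl_inr _ _ h)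
    · exact Or.inl (inl_inr _ _ h.symm).symm
    · obtain ⟨-, x, y, hxy, rfl, rfl⟩ := insertion_adj_inr_inr.1 h
      -- If `g` sends a point of block `i` into block `0`, injectivity of `g` excludes the case
      -- prescribed by `h1`, so the point is the one that `h3` prescribes.
      have half : ∀ x y, (E (g (E.symm (q (x, y), i)))).2 = 0 → p (.inr x) = .inr y := by
        intro x y h0
        obtain ⟨t, ht⟩ := zero _ h0
        rcases hpt : p (.inr t) with k | k
        · have := h1 k t (by rw [← hpt, hp])
          have := g.injective (ht.trans this.symm)
          simp [hi] at this
        · have := h3 t k hpt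
          have := g.injective (ht.trans this.symm)
          simp only [EmbeddingLike.apply_eq_iff_eq, Prod.mk.injEq, and_true] at this
          rw [this.1, this.2, hpt]
      by_cases h0 : (E (g (E.symm (q (x, y), i)))).2 = 0
      · have hx := half _ _ h0
        have hy : p (.inr y) = .inr x := by rw [← hx, hp]
        exact Or.inr ⟨_, _, c1 _ _ (by simpa using hi) (h3 _ _ hx),
          c1 _ _ (by simpa using hi) (h3 _ _ hy), sadj _ _ (by simpa using hxy) hx⟩
      · have h0' : (E (g (E.symm (q (y, x), i)))).2 ≠ 0 := fun hc =>
          h0 (by rw [h3 x y (by rw [← half _ _ hc, hp])]; simp)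
        exact Or.inl ((c2 _ (by simpa using hi) h0).trans (c2 _ (by simpa using hi) h0').symm)
  -- In the second alternative the middle point also hangs on an upper vertex, and the edge of `b`
  -- completes an edge of the product between the two rows.
  · have bot : ∀ y z, b.graph.Adj (.inr y) (.inl z) →
        c (bottomRows X (.inl z)) = some (.inr y) ∨
        ∃ x, c (bottomRows X (.inl z)) = some (.inl x) ∧ p (.inl x) = .inr y := by
      intro y z h
      have hz : E.symm (y, 0) = g z :=
        insertion_adj_inl_inr.1 (projection_adj.1 (relabelTop_adj.1 h))
      by_cases h0 : (E z).2 = 0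
      · obtain ⟨x, rfl⟩ := zero z h0
        refine Or.inr ⟨x, c0 x, ?_⟩
        rcases hpx : p (.inl x) with k | k
        · have := h2 _ _ hpx
          simp [← hz, hj.symm] at this
        · have := h1 _ _ hpx
          simp [← hz] at this
          rw [this]
      · exact Or.inl (c1 _ _ h0 hz.symm)
    rintro (z | y) (w | y') h
    · obtain ⟨-, x, y, hxy, hz, hw⟩ :=
        insertion_adj_inr_inr.1 (projection_adj.1 (relabelTop_adj.1 h))
      -- A point of block `0` that `g` sends into block `j` can only come from the case `h2`, an
      -- upper vertex that `p` keeps in the upper row.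
      have half : ∀ z x y, E.symm (q (x, y), j) = g z → (E z).2 = 0 →
          p (.inl x) = .inl y ∧ z = E.symm (x, 0) := by
        intro z x y hz h0
        obtain ⟨t, rfl⟩ := zero _ h0
        rcases hpt : p (.inl t) with k | k
        · have := hz.trans (h2 _ _ hpt)
          simp only [EmbeddingLike.apply_eq_iff_eq, Prod.mk.injEq, and_true] at this
          rw [this.1, this.2]
          exact ⟨hpt, rfl⟩
        · have := hz.trans (h1 _ _ hpt)
          simp [hj] at this
      have half' : ∀ z w x y, E.symm (q (x, y), j) = g z → E.symm (q (y, x), j) = g w →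
          (E z).2 = 0 → w = E.symm (y, 0) ∧ z = E.symm (x, 0) ∧ p (.inl x) = .inl y := by
        intro z w x y hz hw h0
        have := half _ _ _ hz h0
        refine ⟨?_, this.2, this.1⟩
        have h' := h2 y x (by rw [← this.1, hp])
        exact g.injective (hw.symm.trans h'.symm)
      by_cases h0 : (E z).2 = 0
      · obtain ⟨rfl, rfl, hxy'⟩ := half' z w x y hz hw h0
        exact Or.inr ⟨_, _, c0 _, c0 _, sadj _ _ (by simpa using hxy) hxy'⟩
      · have h0' : (E w).2 ≠ 0 := by
          intro hc
          obtain ⟨rfl, -, -⟩ := half' w z y x hw hz hc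
          simp at h0
        exact Or.inl ((c2 _ h0 (by simp [← hz, hj])).trans (c2 _ h0' (by simp [← hw, hj])).symm)
    · rcases bot _ _ h.symm with h' | ⟨x, hx, hxy⟩
      · exact Or.inl h'
      · exact Or.inr ⟨_, _, hx, rfl, sadj _ _ (by simp) hxy⟩
    · rcases bot _ _ h with h' | ⟨x, hx, hxy⟩
      · exact Or.inl h'.symm
      · exact Or.inr ⟨_, _, rfl, hx, (sadj _ _ (by simp) hxy).symm⟩
    · exact absurd (projection_adj.1 (relabelTop_adj.1 h)) insertion_adj_inl_inl
  · rintro (x | x) (y | y) ⟨hne, hxy⟩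
    · have hyx : p (.inl y) = .inl x := by rw [← hxy, hp]
      refine ((Relation.ReflTransGen.single (atop x)).tail ?_).tail (atop y).symm
      exact bhook x y _ _ (by simpa using hne) (h2 _ _ hxy) (h2 _ _ hyx)
    · exact (Relation.ReflTransGen.single (atop x)).tail (abot _ _ (h1 _ _ hxy)).symm
    · have hyx : p (.inl y) = .inr x := by rw [← hxy, hp]
      exact (Relation.ReflTransGen.single (abot _ _ (h1 _ _ hyx))).tail (atop y).symm
    · have hyx : p (.inr y) = .inr x := by rw [← hxy, hp]
      refine ((Relation.ReflTransGen.single (abot _ _ (h3 _ _ hxy))).tail ?_).tail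
        (abot _ _ (h3 _ _ hyx)).symm
      exact ahook x y (by simpa using hne)

/-- The involution of `ofPerm h` exchanges the two rows, so the conditions on edges within a row are
vacuous and only the action of `g` on block `0` matters. -/
theorem insertion_mul_ofPerm_mul_projection_eq_ofPerm {j : Fin 4} (hi : i ≠ 0) (hj : j ≠ 0)
    {g h : Equiv.Perm X} (hgh : ∀ x, g (E.symm (x, 0)) = E.symm (h x, 0)) :
    insertion E q i * ofPerm g * projection E q j = ofPerm h := by
  refine insertion_mul_ofPerm_mul_projection hi hj _ g ?_ ?_ ?_
  · intro x y hxy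
    simp only [Sum.elim_inl, Function.comp_apply, Sum.inr.injEq] at hxy
    rw [hgh, hxy]
  · simp
  · simp

end Insertion

end PartialBrauer

/-! ### Word length and the consequences of strong distortion -/

theorem IsProductOfLength.mul {S : Type*} [Semigroup S] {U : Set S} {m n : ℕ} {s t : S}
    (hs : IsProductOfLength U m s) (ht : IsProductOfLength U n t) :
    IsProductOfLength U (m + n) (s * t) := by
  induction ht with
  | of_mem hu => exact hs.mul_mem hu
  | mul_mem _ hu ih => rw [← mul_assoc]; exact ih.mul_mem hu

theorem IsProductOfLength.mem_closure {S : Type*} [Semigroup S] {U : Set S} {n : ℕ} {s : S}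
    (h : IsProductOfLength U n s) : s ∈ Subsemigroup.closure U := by
  induction h with
  | of_mem hu => exact Subsemigroup.subset_closure hu
  | mul_mem _ hu ih => exact MulMemClass.mul_mem ih (Subsemigroup.subset_closure hu)

theorem exists_isProductOfLength {S : Type*} [Semigroup S] {U : Set S} {s : S}
    (h : s ∈ Subsemigroup.closure U) : ∃ n, IsProductOfLength U n s := by
  induction h using Subsemigroup.closure_induction with
  | mem x hx => exact ⟨1, .of_mem hx⟩
  | mul x y _ _ hx hy =>
    obtain ⟨m, hm⟩ := hx
    obtain ⟨n, hn⟩ := hy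
    exact ⟨m + n, hm.mul hn⟩

theorem IsProductOfLength.exists_of_forall {S : Type*} [Semigroup S] {U V : Set S} {M n : ℕ}
    {s : S} (h : IsProductOfLength V n s)
    (hV : ∀ v ∈ V, ∃ m ≤ M, IsProductOfLength U m v) :
    ∃ m ≤ n * M, IsProductOfLength U m s := by
  induction h with
  | of_mem hu => simpa using hV _ hu
  | mul_mem _ hu ih =>
    obtain ⟨k, hk, h1⟩ := ih
    obtain ⟨l, hl, h2⟩ := hV _ hu
    exact ⟨k + l, by rw [add_mul, one_mul]; exact add_le_add hk hl, h1.mul h2⟩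

/-- A semigroup is strongly distorted by two elements, if for all sequences of elements there are
two elements that generate all of them, with a uniform bound on the length of the `n`th one. -/
def StronglyTwoDistorted (S : Type*) [Semigroup S] : Prop :=
  ∃ l : ℕ → ℕ, ∀ s : ℕ → S, ∃ a b : S, ∀ n, ∃ m ≤ l n, IsProductOfLength {a, b} m (s n)

theorem StronglyTwoDistorted.semigroupBergmanProperty {S : Type*} [Semigroup S]
    (h : StronglyTwoDistorted S) : SemigroupBergmanProperty S := by
  obtain ⟨l, hl⟩ := h
  intro U hU
  by_contra! hN
  -- Since `l` does not depend on the sequence, a sequence of bad elements can be chosen in terms of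
  -- `l`. The factor `n` will outgrow the lengths of the two generators over `U`.
  choose s hs using fun n : ℕ => hN (l n * n)
  obtain ⟨a, b, hab⟩ := hl s
  have gen : ∀ t : S, ∃ n, IsProductOfLength U n t := fun t =>
    exists_isProductOfLength (hU ▸ Subsemigroup.mem_top t)
  obtain ⟨i, hi⟩ := gen a
  obtain ⟨j, hj⟩ := gen b
  obtain ⟨m, hm, hms⟩ := hab (max i j)
  obtain ⟨k, hk, hks⟩ := hms.exists_of_forall (U := U) (M := max i j) (by
    rintro v (rfl | rfl)
    · exact ⟨i, le_max_left _ _, hi⟩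
    · exact ⟨j, le_max_right _ _, hj⟩)
  exact hs _ k (hk.trans (Nat.mul_le_mul_right _ hm)) hks

theorem commute_of_mem_closure_singleton {S : Type*} [Semigroup S] {u x y : S}
    (hx : x ∈ Subsemigroup.closure {u}) (hy : y ∈ Subsemigroup.closure {u}) : Commute x y := by
  induction hx, hy using Subsemigroup.closure_induction₂ with
  | mem x y hx hy => rw [Set.mem_singleton_iff.1 hx, Set.mem_singleton_iff.1 hy]
  | mul_left x y z _ _ _ h1 h2 => exact h1.mul_left h2
  | mul_right x y z _ _ _ h1 h2 => exact h1.mul_right h2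

theorem StronglyTwoDistorted.sierpinskiRank_eq_two {S : Type*} [Semigroup S]
    (h : StronglyTwoDistorted S) {x y : S} (hxy : ¬ Commute x y) : sierpinskiRank S = 2 := by
  classical
  refine le_antisymm ?_ ?_
  · refine iInf₂_le_of_le 2 ?_ le_rfl
    intro C hC
    obtain ⟨l, hl⟩ := h
    -- The empty set is not the range of a sequence.
    rcases C.eq_empty_or_nonempty with rfl | hne
    · exact ⟨∅, by simp, by simp⟩
    obtain ⟨s, rfl⟩ := hC.exists_eq_range hne
    obtain ⟨a, b, hab⟩ := hl s
    refine ⟨{a, b}, Finset.card_le_two, ?_⟩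
    rintro _ ⟨n, rfl⟩
    obtain ⟨m, -, hm⟩ := hab n
    simpa using hm.mem_closure
  · refine le_iInf₂ fun n hn => ?_
    by_contra! hlt
    have hn1 : n ≤ 1 := by
      have : n < 2 := by exact_mod_cast hlt
      omega
    obtain ⟨U, hU, hC⟩ := hn {x, y} (Set.toFinite _).countable
    have : Nonempty S := ⟨x⟩
    obtain ⟨u, hu⟩ := Finset.card_le_one_iff_subset_singleton.1 (hU.trans hn1)
    have hmono := Subsemigroup.closure_mono
      (show (U : Set S) ⊆ {u} from fun v hv => by simpa using hu hv)
    exact hxy (commute_of_mem_closure_singleton (hmono (hC (by simp))) (hmono (hC (by simp))))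

/-! ### Encoding a Brauer graph by an involution of `X` -/

namespace PartialBrauer

variable {X : Type*}

open Classical in
/-- An involution of `X` that links the copies of `X` in blocks `0` and `1` to each other, to block
`2` and to block `3`, in the way prescribed by an involution of `X ⊕ X`. -/
theorem exists_perm_of_involutive (E : X ≃ X × Fin 4) (q : X × X ≃ X) {p : X ⊕ X → X ⊕ X}
    (hp : Function.Involutive p) : ∃ g : Equiv.Perm X, g * g = 1 ∧
      (∀ x y, p (Sum.inl x) = Sum.inr y → g (E.symm (x, 0)) = E.symm (y, 1)) ∧
      (∀ x w, p (Sum.inl x) = Sum.inl w → g (E.symm (x, 0)) = E.symm (q (x, w), 3)) ∧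
      (∀ y w, p (Sum.inr y) = Sum.inr w → g (E.symm (q (y, w), 2)) = E.symm (y, 1)) := by
  -- Upper vertices live in block `0` and lower ones in block `1`, so that an edge between the rows
  -- becomes a transposition. A vertex matched within its row, or isolated, is exchanged with a pair
  -- in block `3` (upper) or `2` (lower); unused pairs are fixed.
  let t : X × Fin 4 → X × Fin 4
    | (x, 0) => Sum.elim (fun w => (q (x, w), 3)) (fun y => (y, 1)) (p (.inl x))
    | (y, 1) => Sum.elim (fun x => (x, 0)) (fun w => (q (y, w), 2)) (p (.inr y))
    | (z, 2) => if p (.inr (q.symm z).1) = .inr (q.symm z).2 then ((q.symm z).1, 1) else (z, 2)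
    | (z, 3) => if p (.inl (q.symm z).1) = .inl (q.symm z).2 then ((q.symm z).1, 0) else (z, 3)
  have ht : Function.Involutive t := by
    rintro ⟨x, i⟩
    fin_cases i
    · rcases h : p (.inl x) with w | y
      · simp [t, h]
      · have h' : p (.inr y) = .inl x := by rw [← h, hp]
        simp [t, h, h']
    · rcases h : p (.inr x) with w | y
      · have h' : p (.inl w) = .inr x := by rw [← h, hp]
        simp [t, h, h']
      · simp [t, h]
    · obtain ⟨⟨y, w⟩, rfl⟩ := q.surjective x
      by_cases h : p (.inr y) = .inr w
      · simp [t, h]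
      · simp [t, h]
    · obtain ⟨⟨y, w⟩, rfl⟩ := q.surjective x
      by_cases h : p (.inl y) = .inl w
      · simp [t, h]
      · simp [t, h]
  refine ⟨E.symm.permCongr ht.toPerm, ?_, ?_, ?_, ?_⟩
  · ext x
    simp [Equiv.permCongr_apply, ht _]
  · intro x y h
    simp [Equiv.permCongr_apply, t, h]
  · intro x y h
    simp [Equiv.permCongr_apply, t, h]
  · intro x y h
    simp [Equiv.permCongr_apply, t, h]

end PartialBrauer

/-! ### Bounded word length -/

/-- `IsProductOfLengthLE U n s`: the element `s` is a product of at least one and at most `n`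
elements of `U`. -/
def IsProductOfLengthLE {S : Type*} [Semigroup S] (U : Set S) (n : ℕ) (s : S) : Prop :=
  ∃ m ≤ n, IsProductOfLength U m s

theorem IsProductOfLengthLE.mul {S : Type*} [Semigroup S] {U : Set S} {m n : ℕ} {s t : S}
    (hs : IsProductOfLengthLE U m s) (ht : IsProductOfLengthLE U n t) :
    IsProductOfLengthLE U (m + n) (s * t) := by
  obtain ⟨k, hk, hs⟩ := hs
  obtain ⟨l, hl, ht⟩ := ht
  exact ⟨k + l, add_le_add hk hl, hs.mul ht⟩

theorem IsProductOfLengthLE.of_mem {S : Type*} [Semigroup S] {U : Set S} {u : S} (hu : u ∈ U) :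
    IsProductOfLengthLE U 1 u :=
  ⟨1, le_rfl, .of_mem hu⟩

/-- The exponent is `k + 1` because an empty product does not count as a word. -/
theorem IsProductOfLengthLE.pow {S : Type*} [Monoid S] {U : Set S} {n : ℕ} {s : S}
    (hs : IsProductOfLengthLE U n s) (k : ℕ) : IsProductOfLengthLE U ((k + 1) * n) (s ^ (k + 1)) := by
  induction k with
  | zero => simpa using hs
  | succ k ih =>
    rw [pow_succ s (k + 1), add_mul (k + 1) 1 n, one_mul]
    exact ih.mul hs

/-! ### Block permutations, nested copies and the two generators -/

namespace PartialBrauer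

variable {X : Type*}

section Blocks

variable (E : X ≃ X × Fin 4)

/-- The permutation of `X` that permutes its four blocks. -/
def permBlocks (c : Equiv.Perm (Fin 4)) : Equiv.Perm X :=
  E.symm.permCongr (Equiv.prodCongr (Equiv.refl X) c)

/-- The permutation of `X` that acts on each of its four blocks. -/
def permInBlocks (r : Fin 4 → Equiv.Perm X) : Equiv.Perm X :=
  E.symm.permCongr (Equiv.prodCongrLeft r)

/-- A sequence of pairwise disjoint copies of `X` in `X`, obtained from block `1` by repeated
insertion in block `0`. -/
def copies : ℕ → X → X
  | 0, x => E.symm (x, 1)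
  | n + 1, x => E.symm (copies n x, 0)

theorem copies_injective : Function.Injective fun a : ℕ × X => copies E a.1 a.2 := by
  rintro ⟨m, x⟩ ⟨n, y⟩ h
  simp only at h
  induction m generalizing n with
  | zero =>
    cases n with
    | zero => simpa [copies] using h
    | succ n => simp [copies] at h
  | succ m ih =>
    cases n with
    | zero => simp [copies] at h
    | succ n =>
      simp only [copies, EmbeddingLike.apply_eq_iff_eq, Prod.mk.injEq, and_true] at h
      have := ih n h
      simp only [Prod.mk.injEq] at this ⊢
      exact ⟨by rw [this.1], this.2⟩

/-- The permutation of `X` that acts on each of the disjoint copies of `X` in `X`. -/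
noncomputable def permInCopies (t : ℕ → Equiv.Perm X) : Equiv.Perm X :=
  Equiv.Perm.viaEmbedding (Equiv.prodCongrRight t) ⟨_, copies_injective E⟩

variable {E}

theorem permBlocks_apply (c : Equiv.Perm (Fin 4)) (x : X) (i : Fin 4) :
    permBlocks E c (E.symm (x, i)) = E.symm (x, c i) := by
  simp [permBlocks, Equiv.permCongr_apply]

theorem permInBlocks_apply (r : Fin 4 → Equiv.Perm X) (x : X) (i : Fin 4) :
    permInBlocks E r (E.symm (x, i)) = E.symm (r i x, i) := by
  simp [permInBlocks, Equiv.permCongr_apply]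

theorem perm_ext_blocks {g h : Equiv.Perm X}
    (H : ∀ x i, g (E.symm (x, i)) = h (E.symm (x, i))) : g = h := by
  ext x
  obtain ⟨⟨x, i⟩, rfl⟩ := E.symm.surjective x
  exact H x i

theorem permInCopies_copies (t : ℕ → Equiv.Perm X) (n : ℕ) (x : X) :
    permInCopies E t (copies E n x) = copies E n (t n x) :=
  Equiv.Perm.viaEmbedding_apply (Equiv.prodCongrRight t) ⟨_, copies_injective E⟩ (n, x)

theorem permInCopies_block_one (t : ℕ → Equiv.Perm X) (x : X) :
    permInCopies E t (E.symm (x, 1)) = E.symm (t 0 x, 1) :=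
  permInCopies_copies t 0 x

/-- Block `0` contains the copies from the second one on, arranged as all the copies are in `X`.
Restriction to it therefore shifts the sequence, and this makes every term accessible. -/
theorem permInCopies_block_zero (t : ℕ → Equiv.Perm X) (x : X) :
    permInCopies E t (E.symm (x, 0)) = E.symm (permInCopies E (fun n => t (n + 1)) x, 0) := by
  by_cases hx : ∃ n y, copies E n y = x
  · obtain ⟨n, y, rfl⟩ := hx
    rw [permInCopies_copies]
    exact permInCopies_copies t (n + 1) y
  · have h1 : permInCopies E (fun n => t (n + 1)) x = x := by
      refine Equiv.Perm.viaEmbedding_apply_of_notMem _ _ _ ?_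
      rintro ⟨⟨n, y⟩, h⟩
      exact hx ⟨n, y, h⟩
    rw [h1]
    refine Equiv.Perm.viaEmbedding_apply_of_notMem _ _ _ ?_
    rintro ⟨⟨_ | n, y⟩, h⟩
    · simp [copies] at h
    · simp only [Function.Embedding.coeFn_mk, copies, EmbeddingLike.apply_eq_iff_eq,
        Prod.mk.injEq, and_true] at h
      exact hx ⟨n, y, h⟩

theorem permInCopies_mul_self {t : ℕ → Equiv.Perm X} (ht : ∀ n, t n * t n = 1) :
    permInCopies E t * permInCopies E t = 1 := by
  have h : (Equiv.prodCongrRight t * Equiv.prodCongrRight t : Equiv.Perm (ℕ × X)) = 1 := by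
    ext1 ⟨n, x⟩
    simpa using Equiv.congr_fun (ht n) x
  rw [permInCopies, ← Equiv.Perm.viaEmbeddingHom_apply, ← map_mul, h, map_one]

end Blocks

theorem stronglyTwoDistorted (X : Type*) [Infinite X] :
    StronglyTwoDistorted (PartialBrauer X) := by
  classical
  obtain ⟨E⟩ : Nonempty (X ≃ X × Fin 4) := by
    rw [← Cardinal.lift_mk_eq']
    have h : Cardinal.mk X * 4 = Cardinal.mk X :=
      Cardinal.mul_eq_left (Cardinal.aleph0_le_mk X)
        ((Cardinal.natCast_lt_aleph0 (n := 4)).le.trans (Cardinal.aleph0_le_mk X)) (by norm_num)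
    simp [h]
  obtain ⟨q⟩ : Nonempty (X × X ≃ X) := by
    rw [← Cardinal.eq]
    simp [Cardinal.mul_eq_self, Cardinal.aleph0_le_mk]
  -- The summands are the lengths found below: `1` for `a`, `11` for `D`, `8` for `g₃`, `16` for its
  -- square, `54` for `e` and `12` for each shift. The inner bracket is the length of the
  -- permutation `t n`.
  refine ⟨fun n => (1 + (1 + 8 + (54 + n * 12) + 16 + 11) + 16) + 11, fun s => ?_⟩
  choose p hp hs using fun n => exists_eq_ofInvolutive (s n)
  choose t ht t1 t2 t3 using fun n => exists_perm_of_involutive E q (hp n)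
  -- the permutations that make up the two generators
  let c : Equiv.Perm (Fin 4) := Equiv.swap 0 1 * Equiv.swap 1 2
  have hc1 : c (c 1) = 0 := by decide
  have hc3 : c (c 3) = 3 := by decide
  have hc0 : c 0 = 1 := by decide
  let g₃ := permBlocks E c
  let d := permBlocks E (Equiv.swap 0 3)
  let e := permInCopies E t
  -- Block `0` yields `d`, which swaps blocks `0` and `3` and so gives access to `e`. As `c` fixes
  -- `3` and the other blocks all carry `d`, `g₂` commutes with `g₃`.
  let g₂ := permInBlocks E fun i => if i = 3 then e else d
  have hd : d * d = 1 := perm_ext_blocks (E := E) fun x i => by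
    simp [d, permBlocks_apply]
  have he : e * e = 1 := permInCopies_mul_self ht
  have hg₂ : g₂ ^ 2 = 1 := perm_ext_blocks (E := E) fun x i => by
    have hd' : d (d x) = x := Equiv.congr_fun hd x
    have he' : e (e x) = x := Equiv.congr_fun he x
    by_cases hi : i = 3 <;> simp [pow_two, g₂, permInBlocks_apply, hi, hd', he']
  have hg₃ : g₃ ^ 3 = 1 := perm_ext_blocks (E := E) fun x i => by
    have hc : c (c (c i)) = i := by revert i; decide
    simp [pow_succ, g₃, permBlocks_apply, hc]
  have hcomm : Commute g₂ g₃ := perm_ext_blocks (E := E) fun x i => by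
    have hc : c i = 3 ↔ i = 3 := by revert i; decide
    simp [g₂, g₃, permInBlocks_apply, permBlocks_apply, hc]
  -- Commuting factors with `g₂ ^ 2 = 1` and `g₃ ^ 3 = 1` are both powers of their product; this is
  -- why the encodings had to be involutions.
  let g := g₂ * g₃
  have hg3 : g ^ 3 = g₂ := by
    rw [hcomm.mul_pow, hg₃, mul_one, pow_succ, hg₂, one_mul]
  have hg4 : g ^ 4 = g₃ := by
    rw [hcomm.mul_pow, pow_succ g₃, hg₃, one_mul, pow_mul g₂ 2 2, hg₂, one_pow, one_mul]
  have hg6 : g ^ 6 = 1 := by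
    rw [pow_mul g 3 2, hg3, hg₂]
  let a := insertion E q 2
  let D := projection E q 3
  have compress : ∀ {g h : Equiv.Perm X}, (∀ x, g (E.symm (x, 0)) = E.symm (h x, 0)) →
      a * ofPerm g * D = ofPerm h := fun H =>
    insertion_mul_ofPerm_mul_projection_eq_ofPerm (by decide) (by decide) H
  have haD : a * D = 1 := by
    have := compress (g := 1) (h := 1) fun x => rfl
    rwa [ofPerm_one, mul_one] at this
  -- Since `a * D = 1`, the product `a * b` recovers `g`, and `b` followed by the inverse `g ^ 5`
  -- recovers `D`.
  let b := D * ofPerm g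
  refine ⟨a, b, fun n => ?_⟩
  change IsProductOfLengthLE {a, b} _ (s n)
  have wa : IsProductOfLengthLE {a, b} 1 a := .of_mem (by simp)
  have wb : IsProductOfLengthLE {a, b} 1 b := .of_mem (by simp)
  have wg : IsProductOfLengthLE {a, b} 2 (ofPerm g) := by
    have := wa.mul wb
    rwa [← mul_assoc, haD, one_mul] at this
  have wD : IsProductOfLengthLE {a, b} 11 D := by
    -- `wg.pow 4` is about the fifth power, so the length is `1 + 5 * 2`.
    have := wb.mul (wg.pow 4)
    rwa [mul_assoc, ← pow_succ', ofPerm_pow, hg6, ofPerm_one, mul_one] at this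
  have wg₂ : IsProductOfLengthLE {a, b} 6 (ofPerm g₂) := by
    have := wg.pow 2
    rwa [ofPerm_pow, hg3] at this
  have wg₃ : IsProductOfLengthLE {a, b} 8 (ofPerm g₃) := by
    have := wg.pow 3
    rwa [ofPerm_pow, hg4] at this
  have wg₃' : IsProductOfLengthLE {a, b} 16 (ofPerm (g₃ ^ 2)) := by
    have := wg₃.pow 1
    rwa [ofPerm_pow] at this
  have wd : IsProductOfLengthLE {a, b} 18 (ofPerm d) := by
    have := (wa.mul wg₂).mul wD
    rwa [compress (h := d) fun x => by simp [g₂, permInBlocks_apply]] at this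
  have we : IsProductOfLengthLE {a, b} 54 (ofPerm e) := by
    -- Conjugation by `d` brings the action of `g₂` on block `3` to block `0`.
    have := (wa.mul ((wd.mul wg₂).mul wd)).mul wD
    rwa [ofPerm_mul, ofPerm_mul, compress (h := e) fun x => by
      simp [g₂, d, permInBlocks_apply, permBlocks_apply]] at this
  have we' : IsProductOfLengthLE {a, b} (54 + n * 12)
      (ofPerm (permInCopies E fun m => t (m + n))) := by
    induction n with
    | zero => exact we
    | succ n ih =>
      have := (wa.mul ih).mul wD
      rw [compress (permInCopies_block_zero _)] at this
      have h1 : 54 + (n + 1) * 12 = 1 + (54 + n * 12) + 11 := by ring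
      have h2 : (fun m => t (m + (n + 1))) = fun m => t (m + 1 + n) :=
        funext fun m => congrArg t (by ring)
      rwa [h1, h2]
  have wt : IsProductOfLengthLE {a, b} (1 + 8 + (54 + n * 12) + 16 + 11) (ofPerm (t n)) := by
    -- After `n` shifts the term `t n` acts on block `1`; conjugation by `g₃` moves this action to
    -- block `0`.
    have := (((wa.mul wg₃).mul we').mul wg₃').mul wD
    rwa [mul_assoc a, ofPerm_mul, mul_assoc a, ofPerm_mul, compress (h := t n) fun x => by
      simp [g₃, permBlocks_apply, permInCopies_block_one, pow_two, hc0, hc1]] at this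
  -- The square of `g₃` carries block `1` to block `0` and fixes block `3`, which turns the
  -- properties of `t n` into those required with `i = 2` and `j = 3`.
  have := ((wa.mul wt).mul wg₃').mul wD
  rwa [mul_assoc a, ofPerm_mul, insertion_mul_ofPerm_mul_projection (by decide) (by decide) (hp n),
    ← hs n] at this
  · intro x y h
    simp [t1 n x y h, pow_two, g₃, permBlocks_apply, hc1]
  · intro x y h
    simp [t2 n x y h, pow_two, g₃, permBlocks_apply, hc3]
  · intro x y h
    simp [t3 n x y h, pow_two, g₃, permBlocks_apply, hc1]

theorem exists_not_commute (X : Type*) [Infinite X] :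
    ∃ a b : PartialBrauer X, ¬ Commute a b := by
  classical
  obtain ⟨f⟩ : Nonempty (ℕ ↪ X) := ⟨Infinite.natEmbedding X⟩
  refine ⟨ofPerm (Equiv.swap (f 0) (f 1)), ofPerm (Equiv.swap (f 1) (f 2)), fun h => ?_⟩
  have h' := h.eq
  rw [ofPerm_mul, ofPerm_mul] at h'
  have := Equiv.congr_fun (ofPerm_injective h') (f 0)
  simp [Equiv.swap_apply_def] at this

end PartialBrauer

theorem theorem8 (X : Type*) [Infinite X] :
    SemigroupBergmanProperty (PartialBrauer X) ∧ sierpinskiRank (PartialBrauer X) = 2 := by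
  obtain ⟨a, b, hab⟩ := PartialBrauer.exists_not_commute X
  have h := PartialBrauer.stronglyTwoDistorted X
  exact ⟨h.semigroupBergmanProperty, h.sierpinskiRank_eq_two hab⟩
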